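/- Let $E_8$ be the root lattice of type $E_8$, i.e. the lattice $\mathbb{Z}^8$ with the integral bilinear form $(\cdot,\cdot)$ whose Gram matrix is the Cartan matrix of type $E_8$, and let $O(E_8)$ be its isometry group, i.e. the group of all $\mathbb{Z}$-linear automorphisms of $E_8$ that preserve $(\cdot,\cdot)$. A root is a vector $r \in E_8$ with $(r,r)=2$, and $h\in O(E_8)$ is called rootless if the sublattice $(h-1)E_8=\{hx-x : x\in E_8\}$ contains no roots. Then there is no rootless element of order $12$ in $O(E_8)$. -/

import Mathlib

/-- The group `O(M)` of isometries of a lattice `M` whose integral bilinear form is `B`: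
the `ℤ`-linear automorphisms of `M` that preserve `B`. -/
def latticeIsometryGroup {M : Type*} [AddCommGroup M] (B : LinearMap.BilinForm ℤ M) :
    Subgroup (M ≃ₗ[ℤ] M) where
  carrier := {g | ∀ x y : M, B (g x) (g y) = B x y}
  one_mem' := fun _ _ => rfl
  mul_mem' := fun {g h} hg hh x y => (hg (h x) (h y)).trans (hh x y)
  inv_mem' := fun {g} hg x y => by
    have key := hg (g⁻¹ x) (g⁻¹ y)
    have e : ∀ z : M, g (g⁻¹ z) = z := fun z => g.apply_symm_apply z
    rw [e, e] at key
    exact key.symm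

/-- A root of a lattice is a vector of norm `(r, r) = 2`. -/
def IsLatticeRoot {M : Type*} [AddCommGroup M] (B : LinearMap.BilinForm ℤ M) (r : M) : Prop :=
  B r r = 2

/-- An isometry `h` of a lattice `M` is rootless if the sublattice `(h - 1) M` contains
no roots. -/
def IsRootless {M : Type*} [AddCommGroup M] (B : LinearMap.BilinForm ℤ M)
    (h : latticeIsometryGroup B) : Prop :=
  ∀ r ∈ LinearMap.range ((h : M ≃ₗ[ℤ] M).toLinearMap - LinearMap.id), ¬ IsLatticeRoot B r

/-- The bilinear form of the `E₈` lattice. The lattice itself is `ℤ⁸`, whose standard basis is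
a system of simple roots: its Gram matrix is the Cartan matrix of type `E₈`. -/
def e8Form : LinearMap.BilinForm ℤ (Fin 8 → ℤ) :=
  Matrix.toBilin' CartanMatrix.E₈

/-! Let g be rootless with g^12 = 1. For a root r, the vector g^k r - r lies in (g - 1)E_8 and has
norm 4 - 2(r, g^k r), so (r, g^k r) is never 1 and lies in {2, 0, -1, -2}. Positivity of the Gram
matrix of the orbit of r, and the bound 8 on its rank, leave 17 possibilities for the tuple of (r,
g^k r), 1 ≤ k ≤ 6 (`profile_mem_admissibleProfiles`).

By the 4-design property, the sums over the positive roots of (r, g^k r), and of products of two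
such numbers, are polynomials in the traces t_k of g^k (`sum_correlation`, `sum_correlation_mul`).
These identities exclude two more profiles, the only ones for which r has a component in the
eigenspaces for primitive 12th roots of unity. In the other 15 profiles r is fixed by g^4 or by g^6.
Summing (2 - (r, g^4 r))(2 - (r, g^6 r)) = 0 then yields (8 - t_4)(8 - t_6) = 0, whence g^4 = 1 or
g^6 = 1, and the order is not 12.

Completeness of the list of roots is never needed: the norms, the simple roots, the number 120 and
the two moments suffice. -/

open Matrix

/-! ### The roots of E_8 and their moments -/

/-- The 120 positive roots of `E₈`: the decimal digits of a code are the coefficients of the root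
with respect to the simple roots. -/
def e8RootCodes : Finset ℕ :=
  ⟨([
    1, 10, 11, 100, 110, 111, 1000, 1100, 1110, 1111, 10000, 11000, 11100, 11110, 11111, 100000,
    110000, 111000, 111100, 111110, 111111, 1000000, 1010000, 1011000, 1011100, 1011110, 1011111,
    1110000, 1111000, 1111100, 1111110, 1111111, 1121000, 1121100, 1121110, 1121111, 1122100,
    1122110, 1122111, 1122210, 1122211, 1122221, 10000000, 10100000, 10110000, 10111000, 10111100,
    10111110, 10111111, 11110000, 11111000, 11111100, 11111110, 11111111, 11121000, 11121100,
    11121110, 11121111, 11122100, 11122110, 11122111, 11122210, 11122211, 11122221, 11221000,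
    11221100, 11221110, 11221111, 11222100, 11222110, 11222111, 11222210, 11222211, 11222221,
    11232100, 11232110, 11232111, 11232210, 11232211, 11232221, 11233210, 11233211, 11233221,
    11233321, 12232100, 12232110, 12232111, 12232210, 12232211, 12232221, 12233210, 12233211,
    12233221, 12233321, 12243210, 12243211, 12243221, 12243321, 12244321, 12343210, 12343211,
    12343221, 12343321, 12344321, 12354321, 13354321, 22343210, 22343211, 22343221, 22343321,
    22344321, 22354321, 22454321, 23354321, 23454321, 23464321, 23465321, 23465421, 23465431,
    23465432] : List ℕ), by decide +kernel⟩

/-- The vector of `ℤ⁸` whose coordinates are the decimal digits of `n`. -/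
def digitVector (n : ℕ) : Fin 8 → ℤ := fun i => ((n / 10 ^ (7 - i.val) % 10 : ℕ) : ℤ)

/-- The inverse of the Cartan matrix of type `E₈`. -/
def e8Inverse : Matrix (Fin 8) (Fin 8) ℤ :=
  !![4, 5, 7, 10, 8, 6, 4, 2;
     5, 8, 10, 15, 12, 9, 6, 3;
     7, 10, 14, 20, 16, 12, 8, 4;
     10, 15, 20, 30, 24, 18, 12, 6;
     8, 12, 16, 24, 20, 15, 10, 5;
     6, 9, 12, 18, 15, 12, 8, 4;
     4, 6, 8, 12, 10, 8, 6, 3;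
     2, 3, 4, 6, 5, 4, 3, 2]

theorem cartan_mul_e8Inverse : CartanMatrix.E₈ * e8Inverse = 1 := by decide +kernel

theorem e8Inverse_mul_cartan : e8Inverse * CartanMatrix.E₈ = 1 := by decide +kernel

theorem e8Root_norm : ∀ n ∈ e8RootCodes,
    digitVector n ⬝ᵥ CartanMatrix.E₈.mulVec (digitVector n) = 2 := by
  decide +kernel

theorem single_mem_e8Roots (i : Fin 8) :
    ∃ n ∈ e8RootCodes, digitVector n = Pi.single i 1 := by
  refine ⟨10 ^ (7 - i.val), ?_⟩
  revert i
  decide +kernel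

/-- A symmetric 2-tensor invariant under the Weyl group is a multiple of the inverse form; pairing
it with the form gives the factor 30 = 120 · 2 / 8. -/
theorem e8Roots_second_moment : ∀ i j : Fin 8,
    ∑ n ∈ e8RootCodes, digitVector n i * digitVector n j = 30 * e8Inverse i j := by
  decide +kernel

/-- A symmetric statement about four elements of a linear order holds if it holds for
sorted arguments. -/
theorem forall_of_forall_sorted {α : Type*} [LinearOrder α] {P : α → α → α → α → Prop}
    (h₁ : ∀ i j k l, P i j k l → P j i k l) (h₂ : ∀ i j k l, P i j k l → P i k j l)
    (h₃ : ∀ i j k l, P i j k l → P i j l k)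
    (hs : ∀ i j k l, i ≤ j → j ≤ k → k ≤ l → P i j k l) (i j k l : α) : P i j k l := by
  have three : ∀ i j k l, i ≤ j → j ≤ k → P i j k l := by
    intro i j k l hij hjk
    rcases le_total k l with hkl | hkl
    · exact hs _ _ _ _ hij hjk hkl
    apply h₃
    rcases le_total j l with hjl | hjl
    · exact hs _ _ _ _ hij hjl hkl
    apply h₂
    rcases le_total i l with hil | hil
    · exact hs _ _ _ _ hil hjl hjk
    · exact h₁ _ _ _ _ (hs _ _ _ _ hil hij hjk)
  have two : ∀ i j k l, i ≤ j → P i j k l := by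
    intro i j k l hij
    rcases le_total j k with hjk | hjk
    · exact three _ _ _ _ hij hjk
    apply h₂
    rcases le_total i k with hik | hik
    · exact three _ _ _ _ hik hjk
    · exact h₁ _ _ _ _ (three _ _ _ _ hik hij)
  rcases le_total i j with hij | hij
  · exact two _ _ _ _ hij
  · exact h₁ _ _ _ _ (two _ _ _ _ hij)

theorem e8Inverse_transpose : e8Inverse.transpose = e8Inverse := by decide +kernel

theorem e8Inverse_symm (i j : Fin 8) : e8Inverse i j = e8Inverse j i :=
  congr_fun (congr_fun e8Inverse_transpose j) i

/-- The roots of `E₈` form a spherical `4`-design. -/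
theorem e8Roots_fourth_moment (i j k l : Fin 8) :
    ∑ n ∈ e8RootCodes, digitVector n i * digitVector n j * digitVector n k * digitVector n l =
      6 * (e8Inverse i j * e8Inverse k l + e8Inverse i k * e8Inverse j l +
        e8Inverse i l * e8Inverse j k) := by
  revert i j k l
  -- Symmetry cuts the 4096 index tuples to 330 sorted ones. Contracting with the form twice
  -- explains the factor: 120 · 2² = 6 · (64 + 8 + 8).
  refine forall_of_forall_sorted ?_ ?_ ?_ (by decide +kernel)
  · intro i j k l h
    rw [e8Inverse_symm j i]
    trans ∑ n ∈ e8RootCodes,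
      digitVector n i * digitVector n j * digitVector n k * digitVector n l
    · exact Finset.sum_congr rfl fun n _ => by ring
    · rw [h]
      ring
  · intro i j k l h
    rw [e8Inverse_symm k j, add_comm (e8Inverse i k * _), ← h]
    exact Finset.sum_congr rfl fun n _ => by ring
  · intro i j k l h
    rw [e8Inverse_symm l k, add_right_comm, ← h]
    exact Finset.sum_congr rfl fun n _ => by ring

theorem trace_transpose_mul_eq_sum {n R : Type*} [Fintype n] [CommSemiring R]
    (A M : Matrix n n R) : (Aᵀ * M).trace = ∑ i, ∑ j, A i j * M i j := by
  simp only [trace, diag, mul_apply, transpose_apply]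
  exact Finset.sum_comm

theorem dotProduct_mulVec_eq_sum {n R : Type*} [Fintype n] [CommSemiring R]
    (A : Matrix n n R) (v : n → R) : v ⬝ᵥ A *ᵥ v = ∑ i, ∑ j, A i j * (v i * v j) := by
  simp only [dotProduct, mulVec, Finset.mul_sum]
  exact Finset.sum_congr rfl fun i _ => Finset.sum_congr rfl fun j _ => by ring

theorem sum_e8Roots_quadratic (A : Matrix (Fin 8) (Fin 8) ℤ) :
    ∑ n ∈ e8RootCodes, digitVector n ⬝ᵥ A *ᵥ digitVector n = 30 * (Aᵀ * e8Inverse).trace := by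
  simp only [dotProduct_mulVec_eq_sum, trace_transpose_mul_eq_sum, Finset.mul_sum]
  rw [Finset.sum_comm]
  refine Finset.sum_congr rfl fun i _ => ?_
  rw [Finset.sum_comm]
  refine Finset.sum_congr rfl fun j _ => ?_
  rw [← Finset.mul_sum, e8Roots_second_moment]
  ring

theorem sum_e8Roots_quartic (A B : Matrix (Fin 8) (Fin 8) ℤ) :
    ∑ n ∈ e8RootCodes, (digitVector n ⬝ᵥ A *ᵥ digitVector n) *
        (digitVector n ⬝ᵥ B *ᵥ digitVector n) =
      6 * ((Aᵀ * e8Inverse).trace * (Bᵀ * e8Inverse).trace +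
        (Aᵀ * (e8Inverse * B * e8Inverse)).trace +
        (Aᵀ * (e8Inverse * Bᵀ * e8Inverse)).trace) := by
  have hA : ∀ i j, ∑ n ∈ e8RootCodes, digitVector n i * digitVector n j *
      (digitVector n ⬝ᵥ B *ᵥ digitVector n) =
      6 * (e8Inverse i j * (Bᵀ * e8Inverse).trace + (e8Inverse * B * e8Inverse) i j +
        (e8Inverse * Bᵀ * e8Inverse) i j) := by
    intro i j
    have h1 : (e8Inverse * B * e8Inverse) i j =
        ∑ k, ∑ l, B k l * (e8Inverse i k * e8Inverse j l) := by
      simp only [mul_apply, Finset.sum_mul]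
      rw [Finset.sum_comm]
      refine Finset.sum_congr rfl fun k _ => Finset.sum_congr rfl fun l _ => ?_
      rw [e8Inverse_symm j l]
      ring
    have h2 : (e8Inverse * Bᵀ * e8Inverse) i j =
        ∑ k, ∑ l, B k l * (e8Inverse i l * e8Inverse j k) := by
      simp only [mul_apply, Finset.sum_mul, transpose_apply]
      refine Finset.sum_congr rfl fun k _ => Finset.sum_congr rfl fun l _ => ?_
      rw [e8Inverse_symm j k]
      ring
    rw [h1, h2]
    simp only [dotProduct_mulVec_eq_sum, trace_transpose_mul_eq_sum, Finset.mul_sum]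
    rw [Finset.sum_comm]
    simp only [← Finset.sum_add_distrib, Finset.mul_sum]
    refine Finset.sum_congr rfl fun k _ => ?_
    rw [Finset.sum_comm]
    refine Finset.sum_congr rfl fun l _ => ?_
    have h := e8Roots_fourth_moment i j k l
    trans B k l * ∑ n ∈ e8RootCodes,
      digitVector n i * digitVector n j * digitVector n k * digitVector n l
    · rw [Finset.mul_sum]
      exact Finset.sum_congr rfl fun n _ => by ring
    · rw [h]
      ring
  simp only [dotProduct_mulVec_eq_sum A, trace_transpose_mul_eq_sum A, Finset.mul_sum,
    Finset.sum_mul, ← Finset.sum_add_distrib]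
  rw [Finset.sum_comm]
  refine Finset.sum_congr rfl fun i _ => ?_
  rw [Finset.sum_comm]
  refine Finset.sum_congr rfl fun j _ => ?_
  trans A i j * ∑ n ∈ e8RootCodes, digitVector n i * digitVector n j *
      (digitVector n ⬝ᵥ B *ᵥ digitVector n)
  · rw [Finset.mul_sum]
    exact Finset.sum_congr rfl fun n _ => by ring
  · rw [hA]
    ring

/-- This writes the norm as a sum of squares up to the factor 30. Positive definiteness follows,
because the simple roots occur in the sum. -/
theorem sum_sq_dotProduct_e8Roots (x : Fin 8 → ℤ) :
    ∑ n ∈ e8RootCodes, (digitVector n ⬝ᵥ CartanMatrix.E₈ *ᵥ x) ^ 2 =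
      30 * (x ⬝ᵥ CartanMatrix.E₈ *ᵥ x) := by
  set y := CartanMatrix.E₈ *ᵥ x with hy
  have hx : x = e8Inverse *ᵥ y := by
    rw [hy, mulVec_mulVec, e8Inverse_mul_cartan, one_mulVec]
  have h : ∀ n, (digitVector n ⬝ᵥ y) ^ 2 =
      ∑ i, ∑ j, (y i * y j) * (digitVector n i * digitVector n j) := by
    intro n
    rw [sq, dotProduct, Finset.sum_mul_sum]
    exact Finset.sum_congr rfl fun i _ => Finset.sum_congr rfl fun j _ => by ring
  simp only [h]
  rw [dotProduct_comm, hx, dotProduct_mulVec_eq_sum, Finset.sum_comm, Finset.mul_sum]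
  refine Finset.sum_congr rfl fun i _ => ?_
  rw [Finset.sum_comm, Finset.mul_sum]
  refine Finset.sum_congr rfl fun j _ => ?_
  rw [← Finset.mul_sum, e8Roots_second_moment]
  ring

theorem e8_norm_nonneg (x : Fin 8 → ℤ) : 0 ≤ x ⬝ᵥ CartanMatrix.E₈ *ᵥ x := by
  have h := sum_sq_dotProduct_e8Roots x
  have : 0 ≤ ∑ n ∈ e8RootCodes, (digitVector n ⬝ᵥ CartanMatrix.E₈ *ᵥ x) ^ 2 :=
    Finset.sum_nonneg fun n _ => sq_nonneg _
  linarith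

theorem eq_zero_of_e8_norm_eq_zero {x : Fin 8 → ℤ} (hx : x ⬝ᵥ CartanMatrix.E₈ *ᵥ x = 0) :
    x = 0 := by
  have h := sum_sq_dotProduct_e8Roots x
  rw [hx, mul_zero, Finset.sum_eq_zero_iff_of_nonneg fun n _ => sq_nonneg _] at h
  have hy : CartanMatrix.E₈ *ᵥ x = 0 := by
    funext i
    obtain ⟨n, hn, hi⟩ := single_mem_e8Roots i
    simpa [hi] using h n hn
  rw [← one_mulVec x, ← e8Inverse_mul_cartan, ← mulVec_mulVec, hy, mulVec_zero]

/-! ### Inner products along an orbit, and traces -/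

section Correlation

variable {g : Matrix (Fin 8) (Fin 8) ℤ}

/-- The number `(x, gᵏ x)` for a vector `x` of `E₈`. -/
def correlation (g : Matrix (Fin 8) (Fin 8) ℤ) (x : Fin 8 → ℤ) (k : ℕ) : ℤ :=
  x ⬝ᵥ (CartanMatrix.E₈ * g ^ k) *ᵥ x

theorem cartan_transpose : CartanMatrix.E₈ᵀ = CartanMatrix.E₈ := by decide +kernel

theorem e8_inner_comm (x y : Fin 8 → ℤ) :
    x ⬝ᵥ CartanMatrix.E₈ *ᵥ y = y ⬝ᵥ CartanMatrix.E₈ *ᵥ x := by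
  rw [dotProduct_mulVec, dotProduct_comm, ← mulVec_transpose, cartan_transpose]

theorem pow_isometry (hg : gᵀ * CartanMatrix.E₈ * g = CartanMatrix.E₈) (k : ℕ) :
    (g ^ k)ᵀ * CartanMatrix.E₈ * g ^ k = CartanMatrix.E₈ := by
  induction k with
  | zero => simp
  | succ k ih =>
    calc (g ^ (k + 1))ᵀ * CartanMatrix.E₈ * g ^ (k + 1)
        = gᵀ * ((g ^ k)ᵀ * CartanMatrix.E₈ * g ^ k) * g := by
          rw [pow_succ, transpose_mul]
          simp only [Matrix.mul_assoc]
      _ = CartanMatrix.E₈ := by rw [ih, hg]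

theorem transpose_pow_mul_cartan_mul_pow (hg : gᵀ * CartanMatrix.E₈ * g = CartanMatrix.E₈)
    (i k : ℕ) : (g ^ i)ᵀ * CartanMatrix.E₈ * g ^ (i + k) = CartanMatrix.E₈ * g ^ k := by
  rw [pow_add, ← Matrix.mul_assoc, pow_isometry hg]

theorem inner_pow_pow (hg : gᵀ * CartanMatrix.E₈ * g = CartanMatrix.E₈) (x y : Fin 8 → ℤ)
    (i k : ℕ) : (g ^ i *ᵥ x) ⬝ᵥ CartanMatrix.E₈ *ᵥ (g ^ (i + k) *ᵥ y) =
      x ⬝ᵥ (CartanMatrix.E₈ * g ^ k) *ᵥ y := by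
  rw [← transpose_pow_mul_cartan_mul_pow hg i k, ← mulVec_mulVec, ← mulVec_mulVec,
    dotProduct_mulVec x, vecMul_transpose]

theorem inner_pow_pow_self (hg : gᵀ * CartanMatrix.E₈ * g = CartanMatrix.E₈) (x : Fin 8 → ℤ)
    (i k : ℕ) : (g ^ i *ᵥ x) ⬝ᵥ CartanMatrix.E₈ *ᵥ (g ^ (i + k) *ᵥ x) = correlation g x k :=
  inner_pow_pow hg x x i k

theorem correlation_reflect (hg : gᵀ * CartanMatrix.E₈ * g = CartanMatrix.E₈) {m : ℕ}
    (hm : g ^ m = 1) (x : Fin 8 → ℤ) {i j : ℕ} (hij : i + j = m) :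
    correlation g x i = correlation g x j := by
  rw [← inner_pow_pow_self hg x j i, add_comm j i, hij, hm, one_mulVec, e8_inner_comm,
    mulVec_mulVec]
  rfl

/-- The Cartan matrix conjugates the inverse of g^i, which is g^j, to the transpose of g^i. -/
theorem trace_pow_reflect (hg : gᵀ * CartanMatrix.E₈ * g = CartanMatrix.E₈) {m : ℕ}
    (hm : g ^ m = 1) {i j : ℕ} (hij : i + j = m) : (g ^ i).trace = (g ^ j).trace := by
  have h := transpose_pow_mul_cartan_mul_pow hg i j
  rw [hij, hm, Matrix.mul_one] at h
  rw [← trace_transpose, ← Matrix.mul_one (g ^ i)ᵀ, ← cartan_mul_e8Inverse, ← Matrix.mul_assoc,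
    h, trace_mul_comm, ← Matrix.mul_assoc, e8Inverse_mul_cartan, Matrix.one_mul]

theorem trace_cartan_mul_pow (k : ℕ) :
    ((CartanMatrix.E₈ * g ^ k)ᵀ * e8Inverse).trace = (g ^ k).trace := by
  rw [transpose_mul, cartan_transpose, Matrix.mul_assoc, cartan_mul_e8Inverse, Matrix.mul_one,
    trace_transpose]

theorem sum_correlation (k : ℕ) :
    ∑ n ∈ e8RootCodes, correlation g (digitVector n) k = 30 * (g ^ k).trace := by
  simp only [correlation]
  rw [sum_e8Roots_quadratic, trace_cartan_mul_pow]

/-- The three pairings in the fourth moment give the three terms: the product of the traces, the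
trace of g^(-i) g^(i+k) since the adjoint of g^i is its inverse, and the trace of g^i g^(i+k). -/
theorem sum_correlation_mul (hg : gᵀ * CartanMatrix.E₈ * g = CartanMatrix.E₈) (i k : ℕ) :
    ∑ n ∈ e8RootCodes, correlation g (digitVector n) i * correlation g (digitVector n) (i + k) =
      6 * ((g ^ i).trace * (g ^ (i + k)).trace + (g ^ k).trace + (g ^ (i + (i + k))).trace) := by
  simp only [correlation]
  rw [sum_e8Roots_quartic, trace_cartan_mul_pow, trace_cartan_mul_pow]
  congr 2
  · congr 1
    have : (CartanMatrix.E₈ * g ^ i)ᵀ * (e8Inverse * (CartanMatrix.E₈ * g ^ (i + k)) * e8Inverse) =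
        ((g ^ i)ᵀ * CartanMatrix.E₈ * g ^ (i + k)) * e8Inverse := by
      rw [← Matrix.mul_assoc e8Inverse, e8Inverse_mul_cartan, Matrix.one_mul, transpose_mul,
        cartan_transpose, Matrix.mul_assoc _ _ e8Inverse]
    rw [this, transpose_pow_mul_cartan_mul_pow hg, trace_mul_comm, ← Matrix.mul_assoc,
      e8Inverse_mul_cartan, Matrix.one_mul]
  · have : (CartanMatrix.E₈ * g ^ i)ᵀ *
        (e8Inverse * (CartanMatrix.E₈ * g ^ (i + k))ᵀ * e8Inverse) = (g ^ (i + (i + k)))ᵀ := by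
      rw [transpose_mul, transpose_mul, cartan_transpose, Matrix.mul_assoc e8Inverse,
        Matrix.mul_assoc _ CartanMatrix.E₈ e8Inverse, cartan_mul_e8Inverse, Matrix.mul_one,
        Matrix.mul_assoc, ← Matrix.mul_assoc CartanMatrix.E₈, cartan_mul_e8Inverse,
        Matrix.one_mul, ← transpose_mul, ← pow_add, add_comm]
    rw [this, trace_transpose]

/-- The numbers `(x, gᵏ x)` with `0 ≤ k < 12` for a vector `x` of norm `2` under an isometry
`g` of order dividing `12`, in terms of those with `1 ≤ k ≤ 6`. -/
def cyclicProfile (a₁ a₂ a₃ a₄ a₅ a₆ : ℤ) : Fin 12 → ℤ :=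
  ![2, a₁, a₂, a₃, a₄, a₅, a₆, a₅, a₄, a₃, a₂, a₁]

theorem inner_pow_eq_cyclicProfile (hg : gᵀ * CartanMatrix.E₈ * g = CartanMatrix.E₈)
    (h12 : g ^ 12 = 1) {x : Fin 8 → ℤ} (hx : x ⬝ᵥ CartanMatrix.E₈ *ᵥ x = 2) (i j : Fin 12) :
    (g ^ (i : ℕ) *ᵥ x) ⬝ᵥ CartanMatrix.E₈ *ᵥ (g ^ (j : ℕ) *ᵥ x) =
      cyclicProfile (correlation g x 1) (correlation g x 2) (correlation g x 3)
        (correlation g x 4) (correlation g x 5) (correlation g x 6) (j - i) := by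
  -- Subtraction in `Fin 12` wraps around, which is harmless since g^12 = 1.
  have hj : g ^ (j : ℕ) = g ^ ((i : ℕ) + ((j - i : Fin 12) : ℕ)) := by
    rw [pow_eq_pow_mod _ h12, pow_eq_pow_mod (_ + _) h12]
    congr 1
    omega
  rw [hj, inner_pow_pow_self hg]
  generalize j - i = k
  fin_cases k
  · simpa [correlation, cyclicProfile] using hx
  · rfl
  · rfl
  · rfl
  · rfl
  · rfl
  · rfl
  · exact correlation_reflect hg h12 x (j := 5) rfl
  · exact correlation_reflect hg h12 x (j := 4) rfl
  · exact correlation_reflect hg h12 x (j := 3) rfl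
  · exact correlation_reflect hg h12 x (j := 2) rfl
  · exact correlation_reflect hg h12 x (j := 1) rfl

theorem inner_sum_sum {m : ℕ} (f : Fin m → ℤ) (v : Fin m → Fin 8 → ℤ) :
    (∑ i, f i • v i) ⬝ᵥ CartanMatrix.E₈ *ᵥ (∑ i, f i • v i) =
      ∑ i, ∑ j, f i * f j * (v i ⬝ᵥ CartanMatrix.E₈ *ᵥ v j) := by
  rw [mulVec_sum, sum_dotProduct]
  refine Finset.sum_congr rfl fun i _ => ?_
  rw [dotProduct_sum]
  refine Finset.sum_congr rfl fun j _ => ?_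
  rw [mulVec_smul, smul_dotProduct, dotProduct_smul, smul_eq_mul, smul_eq_mul]
  ring

/-- The right-hand side is the norm of ∑ f_i g^i x, grouped by differences of exponents; `c` is the
cyclic autocorrelation of `f`. -/
theorem cyclicProfile_nonneg (hg : gᵀ * CartanMatrix.E₈ * g = CartanMatrix.E₈)
    (h12 : g ^ 12 = 1) {x : Fin 8 → ℤ} (hx : x ⬝ᵥ CartanMatrix.E₈ *ᵥ x = 2)
    {f c : Fin 12 → ℤ} (hc : ∀ k, ∑ i, f i * f (i + k) = c k) :
    0 ≤ ∑ k, c k *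
      cyclicProfile (correlation g x 1) (correlation g x 2) (correlation g x 3)
        (correlation g x 4) (correlation g x 5) (correlation g x 6) k := by
  have h := e8_norm_nonneg (∑ i, f i • (g ^ (i : ℕ) *ᵥ x))
  rw [inner_sum_sum] at h
  simp only [inner_pow_eq_cyclicProfile hg h12 hx] at h
  refine h.trans_eq ?_
  simp only [← hc, Finset.sum_mul]
  conv_rhs => rw [Finset.sum_comm]
  refine Finset.sum_congr rfl fun i _ => ?_
  rw [← Equiv.sum_comp (Equiv.addLeft i)]
  exact Finset.sum_congr rfl fun k _ => by simp

end Correlation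

/-! ### Restrictions on the profile of a root from positivity and rank -/

/-- The possible values of `(r, gᵏ r)`, `1 ≤ k ≤ 6`, for a root `r` and an isometry `g` of order
dividing `12` for which none of these numbers is `1`, as far as positivity of the Gram matrix of
the orbit is concerned. -/
def positiveProfiles : List (ℤ × ℤ × ℤ × ℤ × ℤ × ℤ) :=
  [(2, 2, 2, 2, 2, 2), (0, 2, 0, 2, 0, 2), (0, 0, 2, 0, 0, 2), (0, 0, 0, 2, 0, 0),
    (0, 0, 0, 0, 0, 2), (0, 0, 0, 0, 0, 0), (0, 0, 0, 0, 0, -1), (0, 0, 0, 0, 0, -2),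
    (0, 0, 0, 0, -1, 0), (0, 0, 0, -1, 0, 0), (0, 0, -1, 0, 0, 2), (0, 0, -1, 0, 0, 0),
    (0, 0, -2, 0, 0, 2), (0, -1, 0, 2, 0, -1), (0, -1, 0, 0, 0, 0), (0, -1, 0, -1, 0, 2),
    (0, -2, 0, 2, 0, -2), (-1, 2, -1, 2, -1, 2), (-1, 0, 0, 0, 0, 0), (-1, 0, 0, 0, -1, 2),
    (-1, 0, -1, 2, -1, 0), (-1, -1, 2, -1, -1, 2), (-2, 2, -2, 2, -2, 2)]

/-- The profiles in `positiveProfiles` for which the orbit of the root has rank at most `8`. -/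
def admissibleProfiles : List (ℤ × ℤ × ℤ × ℤ × ℤ × ℤ) :=
  [(2, 2, 2, 2, 2, 2), (0, 2, 0, 2, 0, 2), (0, 0, 2, 0, 0, 2), (0, 0, 0, 2, 0, 0),
    (0, 0, 0, 0, 0, 2), (0, 0, 0, 0, 0, -2), (0, 0, 0, -1, 0, 0), (0, 0, -1, 0, 0, 2),
    (0, 0, -2, 0, 0, 2), (0, -1, 0, 2, 0, -1), (0, -1, 0, -1, 0, 2), (0, -2, 0, 2, 0, -2),
    (-1, 2, -1, 2, -1, 2), (-1, 0, 0, 0, -1, 2), (-1, 0, -1, 2, -1, 0), (-1, -1, 2, -1, -1, 2),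
    (-2, 2, -2, 2, -2, 2)]

/-- Eight inequalities that express positivity of the Gram matrix of the orbit of a root. -/
def ProfileInequalities (a₁ a₂ a₃ a₄ a₅ a₆ : ℤ) : Prop :=
  0 ≤ 18 + 12 * a₁ + 12 * a₂ + 16 * a₃ + 12 * a₄ + 12 * a₅ + 8 * a₆ ∧
  0 ≤ 18 - 16 * a₁ + 14 * a₂ - 12 * a₃ + 12 * a₄ - 12 * a₅ + 6 * a₆ ∧
  0 ≤ 48 + 24 * a₁ - 24 * a₂ - 48 * a₃ - 24 * a₄ + 24 * a₅ + 24 * a₆ ∧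
  0 ≤ 18 - 6 * a₁ - 8 * a₂ + 14 * a₃ - 6 * a₄ - 8 * a₅ + 6 * a₆ ∧
  0 ≤ 776 + 672 * a₁ + 388 * a₂ - 388 * a₄ - 672 * a₅ - 388 * a₆ ∧
  0 ≤ 10 - 4 * a₁ - 2 * a₂ + 2 * a₄ + 4 * a₅ - 4 * a₆ ∧
  0 ≤ 48 - 48 * a₂ + 48 * a₄ - 24 * a₆ ∧
  0 ≤ 56 - 48 * a₁ + 28 * a₂ - 28 * a₄ + 48 * a₅ - 28 * a₆

instance (a₁ a₂ a₃ a₄ a₅ a₆ : ℤ) : Decidable (ProfileInequalities a₁ a₂ a₃ a₄ a₅ a₆) := by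
  unfold ProfileInequalities
  infer_instance

theorem mem_positiveProfiles :
    ∀ a₁ ∈ ([2, 0, -1, -2] : List ℤ), ∀ a₂ ∈ ([2, 0, -1, -2] : List ℤ),
    ∀ a₃ ∈ ([2, 0, -1, -2] : List ℤ), ∀ a₄ ∈ ([2, 0, -1, -2] : List ℤ),
    ∀ a₅ ∈ ([2, 0, -1, -2] : List ℤ), ∀ a₆ ∈ ([2, 0, -1, -2] : List ℤ),
    ProfileInequalities a₁ a₂ a₃ a₄ a₅ a₆ → (a₁, a₂, a₃, a₄, a₅, a₆) ∈ positiveProfiles := by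
  decide +kernel

section Profile

variable {g : Matrix (Fin 8) (Fin 8) ℤ}

theorem correlation_profileInequalities (hg : gᵀ * CartanMatrix.E₈ * g = CartanMatrix.E₈)
    (h12 : g ^ 12 = 1) {x : Fin 8 → ℤ} (hx : x ⬝ᵥ CartanMatrix.E₈ *ᵥ x = 2) :
    ProfileInequalities (correlation g x 1) (correlation g x 2) (correlation g x 3)
      (correlation g x 4) (correlation g x 5) (correlation g x 6) := by
  unfold ProfileInequalities
  -- Each `f` is an integral test vector. The third, fifth, seventh and eighth are 2cos(60°k),
  -- 8cos(30°k), 2cos(90°k) and 2cos(150°k), rounded where necessary: approximate eigenvectors of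
  -- the cyclic shift.
  refine ⟨?_, ?_, ?_, ?_, ?_, ?_, ?_, ?_⟩
  · have := cyclicProfile_nonneg hg h12 hx (f := ![-1, 0, -1, -1, -1, -1, -1, 0, -1, -1, 0, -1])
      (c := ![9, 6, 6, 8, 6, 6, 8, 6, 6, 8, 6, 6]) (by decide)
    simp [cyclicProfile, Fin.sum_univ_succ] at this
    linarith
  · have := cyclicProfile_nonneg hg h12 hx (f := ![-1, 1, -1, 1, -1, 1, -1, 0, 0, 0, -1, 1])
      (c := ![9, -8, 7, -6, 6, -6, 6, -6, 6, -6, 7, -8]) (by decide)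
    simp [cyclicProfile, Fin.sum_univ_succ] at this
    linarith
  · have := cyclicProfile_nonneg hg h12 hx (f := ![2, 1, -1, -2, -1, 1, 2, 1, -1, -2, -1, 1])
      (c := ![24, 12, -12, -24, -12, 12, 24, 12, -12, -24, -12, 12]) (by decide)
    simp [cyclicProfile, Fin.sum_univ_succ] at this
    linarith
  · have := cyclicProfile_nonneg hg h12 hx (f := ![0, 1, -1, 0, 0, -1, 1, 1, -1, 1, 1, -1])
      (c := ![9, -3, -4, 7, -3, -4, 6, -4, -3, 7, -4, -3]) (by decide)
    simp [cyclicProfile, Fin.sum_univ_succ] at this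
    linarith
  · have := cyclicProfile_nonneg hg h12 hx (f := ![8, 7, 4, 0, -4, -7, -8, -7, -4, 0, 4, 7])
      (c := ![388, 336, 194, 0, -194, -336, -388, -336, -194, 0, 194, 336]) (by decide)
    simp [cyclicProfile, Fin.sum_univ_succ] at this
    linarith
  · have := cyclicProfile_nonneg hg h12 hx (f := ![-1, 1, 0, -1, 0, 0, 1, -1, 0, 0, 0, 0])
      (c := ![5, -2, -1, 0, 1, 2, -4, 2, 1, 0, -1, -2]) (by decide)
    simp [cyclicProfile, Fin.sum_univ_succ] at this
    linarith
  · have := cyclicProfile_nonneg hg h12 hx (f := ![2, 0, -2, 0, 2, 0, -2, 0, 2, 0, -2, 0])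
      (c := ![24, 0, -24, 0, 24, 0, -24, 0, 24, 0, -24, 0]) (by decide)
    simp [cyclicProfile, Fin.sum_univ_succ] at this
    linarith
  · have := cyclicProfile_nonneg hg h12 hx (f := ![2, -2, 1, 0, -1, 2, -2, 2, -1, 0, 1, -2])
      (c := ![28, -24, 14, 0, -14, 24, -28, 24, -14, 0, 14, -24]) (by decide)
    simp [cyclicProfile, Fin.sum_univ_succ] at this
    linarith

end Profile

/-- A product of matrices through a smaller dimension is not a nonzero scalar. -/
theorem mul_ne_smul_one_of_lt {m n : ℕ} (hmn : n < m) (V : Matrix (Fin m) (Fin n) ℤ)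
    (W : Matrix (Fin n) (Fin m) ℤ) {d : ℤ} (hd : d ≠ 0) : V * W ≠ d • 1 := by
  intro h
  have hW : Function.Injective W.mulVecLin := by
    rw [← LinearMap.ker_eq_bot, LinearMap.ker_eq_bot']
    intro v hv
    have : d • v = 0 := by
      rw [← one_mulVec v, ← smul_mulVec, ← h, ← mulVec_mulVec]
      rw [mulVecLin_apply] at hv
      rw [hv, mulVec_zero]
    exact (smul_eq_zero.mp this).resolve_left hd
  have := LinearMap.finrank_le_finrank_of_injective hW
  simp at this
  omega

section Profile

variable {g : Matrix (Fin 8) (Fin 8) ℤ}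

/-- The profile of the correlations of a vector. -/
def profile (g : Matrix (Fin 8) (Fin 8) ℤ) (x : Fin 8 → ℤ) : ℤ × ℤ × ℤ × ℤ × ℤ × ℤ :=
  (correlation g x 1, correlation g x 2, correlation g x 3, correlation g x 4,
    correlation g x 5, correlation g x 6)

/-- The Gram matrix of nine vectors in a lattice of rank `8` has no inverse. -/
theorem false_of_gram_inverse (hg : gᵀ * CartanMatrix.E₈ * g = CartanMatrix.E₈)
    (h12 : g ^ 12 = 1) {x : Fin 8 → ℤ} (hx : x ⬝ᵥ CartanMatrix.E₈ *ᵥ x = 2)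
    {a₁ a₂ a₃ a₄ a₅ a₆ : ℤ} (d : ℤ) (hd : d ≠ 0) (K : Fin 9 → Fin 9 → ℤ)
    (h : profile g x = (a₁, a₂, a₃, a₄, a₅, a₆))
    (hK : ∀ i j : Fin 9, ∑ l : Fin 9, K i l * cyclicProfile a₁ a₂ a₃ a₄ a₅ a₆
      (j.castLE (by decide) - l.castLE (by decide)) = if i = j then d else 0) : False := by
  simp only [profile, Prod.mk.injEq] at h
  obtain ⟨h₁, h₂, h₃, h₄, h₅, h₆⟩ := h
  let V : Matrix (Fin 9) (Fin 8) ℤ := of fun i => g ^ (i : ℕ) *ᵥ x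
  -- The Gram matrix of x, gx, ..., g^8 x factors through rank 8, whereas `K` is d times its
  -- inverse.
  refine mul_ne_smul_one_of_lt (by decide : 8 < 9) (of K * V) (CartanMatrix.E₈ * Vᵀ) hd ?_
  ext i j
  rw [Matrix.mul_assoc, mul_apply, Matrix.smul_apply, one_apply, smul_ite, smul_zero, smul_eq_mul,
    mul_one, ← hK i j]
  refine Finset.sum_congr rfl fun l _ => ?_
  have := inner_pow_eq_cyclicProfile hg h12 hx (l.castLE (by decide)) (j.castLE (by decide))
  rw [h₁, h₂, h₃, h₄, h₅, h₆] at this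
  rw [← this]
  rfl

/-- Since g - 1 divides g^k - 1, the vector g^k x - x is not a root, which excludes the value 1. The
norms of g^k x ± x bound the value by 2 in absolute value. -/
theorem correlation_mem (hg : gᵀ * CartanMatrix.E₈ * g = CartanMatrix.E₈)
    (hroot : ∀ x, (g *ᵥ x - x) ⬝ᵥ CartanMatrix.E₈ *ᵥ (g *ᵥ x - x) ≠ 2)
    {x : Fin 8 → ℤ} (hx : x ⬝ᵥ CartanMatrix.E₈ *ᵥ x = 2) (k : ℕ) :
    correlation g x k ∈ ([2, 0, -1, -2] : List ℤ) := by
  have hk : g ^ k *ᵥ x - x = g *ᵥ ((∑ i ∈ Finset.range k, g ^ i) *ᵥ x) -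
      (∑ i ∈ Finset.range k, g ^ i) *ᵥ x := by
    rw [mulVec_mulVec, ← sub_mulVec, ← sub_one_mul, mul_geom_sum, sub_mulVec, one_mulVec]
  have h1 := hroot ((∑ i ∈ Finset.range k, g ^ i) *ᵥ x)
  rw [← hk] at h1
  have h2 := e8_norm_nonneg (g ^ k *ᵥ x - x)
  have h3 := e8_norm_nonneg (g ^ k *ᵥ x + x)
  have e1 : x ⬝ᵥ CartanMatrix.E₈ *ᵥ (g ^ k *ᵥ x) = correlation g x k := by
    rw [correlation, mulVec_mulVec]
  have e2 : (g ^ k *ᵥ x) ⬝ᵥ CartanMatrix.E₈ *ᵥ (g ^ k *ᵥ x) = 2 := by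
    have := inner_pow_pow hg x x k 0
    rwa [add_zero, pow_zero, Matrix.mul_one, hx] at this
  simp only [mulVec_sub, mulVec_add, sub_dotProduct, add_dotProduct, dotProduct_sub,
    dotProduct_add, e1, e2, hx, e8_inner_comm (g ^ k *ᵥ x) x] at h1 h2 h3
  simp only [List.mem_cons, List.not_mem_nil, or_false]
  omega

theorem profile_mem_admissibleProfiles (hg : gᵀ * CartanMatrix.E₈ * g = CartanMatrix.E₈)
    (h12 : g ^ 12 = 1)
    (hroot : ∀ x, (g *ᵥ x - x) ⬝ᵥ CartanMatrix.E₈ *ᵥ (g *ᵥ x - x) ≠ 2)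
    {x : Fin 8 → ℤ} (hx : x ⬝ᵥ CartanMatrix.E₈ *ᵥ x = 2) :
    profile g x ∈ admissibleProfiles := by
  have hc := correlation_mem hg hroot hx
  have h := mem_positiveProfiles _ (hc 1) _ (hc 2) _ (hc 3) _ (hc 4) _ (hc 5) _ (hc 6)
    (correlation_profileInequalities hg h12 hx)
  have hsub : ∀ p ∈ positiveProfiles, p ∈ admissibleProfiles ++
      [(0, 0, 0, 0, 0, 0), (0, 0, 0, 0, 0, -1), (0, 0, 0, 0, -1, 0), (0, 0, -1, 0, 0, 0),
        (0, -1, 0, 0, 0, 0), (-1, 0, 0, 0, 0, 0)] := by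
    decide
  refine (List.mem_append.mp (hsub _ h)).resolve_right ?_
  simp only [List.mem_cons, List.not_mem_nil, or_false]
  rintro (h | h | h | h | h | h)
  -- In the six cases r, gr, ..., g^8 r are simple roots of types A_1^9, A_2^3 A_1^3, A_4^2 A_1,
  -- A_3^3, A_5 A_4 and A_9, all of rank 9. The matrices are multiples of the inverse Cartan
  -- matrices.
  · exact false_of_gram_inverse hg h12 hx 2 (by decide)
      ![![1, 0, 0, 0, 0, 0, 0, 0, 0],
        ![0, 1, 0, 0, 0, 0, 0, 0, 0],
        ![0, 0, 1, 0, 0, 0, 0, 0, 0],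
        ![0, 0, 0, 1, 0, 0, 0, 0, 0],
        ![0, 0, 0, 0, 1, 0, 0, 0, 0],
        ![0, 0, 0, 0, 0, 1, 0, 0, 0],
        ![0, 0, 0, 0, 0, 0, 1, 0, 0],
        ![0, 0, 0, 0, 0, 0, 0, 1, 0],
        ![0, 0, 0, 0, 0, 0, 0, 0, 1]] h (by decide +kernel)
  · exact false_of_gram_inverse hg h12 hx 6 (by decide)
      ![![4, 0, 0, 0, 0, 0, 2, 0, 0],
        ![0, 4, 0, 0, 0, 0, 0, 2, 0],
        ![0, 0, 4, 0, 0, 0, 0, 0, 2],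
        ![0, 0, 0, 3, 0, 0, 0, 0, 0],
        ![0, 0, 0, 0, 3, 0, 0, 0, 0],
        ![0, 0, 0, 0, 0, 3, 0, 0, 0],
        ![2, 0, 0, 0, 0, 0, 4, 0, 0],
        ![0, 2, 0, 0, 0, 0, 0, 4, 0],
        ![0, 0, 2, 0, 0, 0, 0, 0, 4]] h (by decide +kernel)
  · exact false_of_gram_inverse hg h12 hx 10 (by decide)
      ![![12, 0, 4, 0, 0, 6, 0, 8, 0],
        ![0, 12, 0, 4, 0, 0, 6, 0, 8],
        ![4, 0, 8, 0, 0, 2, 0, 6, 0],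
        ![0, 4, 0, 8, 0, 0, 2, 0, 6],
        ![0, 0, 0, 0, 5, 0, 0, 0, 0],
        ![6, 0, 2, 0, 0, 8, 0, 4, 0],
        ![0, 6, 0, 2, 0, 0, 8, 0, 4],
        ![8, 0, 6, 0, 0, 4, 0, 12, 0],
        ![0, 8, 0, 6, 0, 0, 4, 0, 12]] h (by decide +kernel)
  · exact false_of_gram_inverse hg h12 hx 4 (by decide)
      ![![3, 0, 0, 2, 0, 0, 1, 0, 0],
        ![0, 3, 0, 0, 2, 0, 0, 1, 0],
        ![0, 0, 3, 0, 0, 2, 0, 0, 1],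
        ![2, 0, 0, 4, 0, 0, 2, 0, 0],
        ![0, 2, 0, 0, 4, 0, 0, 2, 0],
        ![0, 0, 2, 0, 0, 4, 0, 0, 2],
        ![1, 0, 0, 2, 0, 0, 3, 0, 0],
        ![0, 1, 0, 0, 2, 0, 0, 3, 0],
        ![0, 0, 1, 0, 0, 2, 0, 0, 3]] h (by decide +kernel)
  · exact false_of_gram_inverse hg h12 hx 30 (by decide)
      ![![25, 0, 20, 0, 15, 0, 10, 0, 5],
        ![0, 24, 0, 18, 0, 12, 0, 6, 0],
        ![20, 0, 40, 0, 30, 0, 20, 0, 10],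
        ![0, 18, 0, 36, 0, 24, 0, 12, 0],
        ![15, 0, 30, 0, 45, 0, 30, 0, 15],
        ![0, 12, 0, 24, 0, 36, 0, 18, 0],
        ![10, 0, 20, 0, 30, 0, 40, 0, 20],
        ![0, 6, 0, 12, 0, 18, 0, 24, 0],
        ![5, 0, 10, 0, 15, 0, 20, 0, 25]] h (by decide +kernel)
  · exact false_of_gram_inverse hg h12 hx 10 (by decide)
      ![![9, 8, 7, 6, 5, 4, 3, 2, 1],
        ![8, 16, 14, 12, 10, 8, 6, 4, 2],
        ![7, 14, 21, 18, 15, 12, 9, 6, 3],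
        ![6, 12, 18, 24, 20, 16, 12, 8, 4],
        ![5, 10, 15, 20, 25, 20, 15, 10, 5],
        ![4, 8, 12, 16, 20, 24, 18, 12, 6],
        ![3, 6, 9, 12, 15, 18, 21, 14, 7],
        ![2, 4, 6, 8, 10, 12, 14, 16, 8],
        ![1, 2, 3, 4, 5, 6, 7, 8, 9]] h (by decide +kernel)

/-- The first eight orbit vectors of x span a sublattice A_2^4 of full rank, killed by 1 + g^4 +
g^8. Hence this operator kills y as well, and (y, g^4 y) = (y, g^8 y). -/
theorem correlation_four_eq_neg_one (hg : gᵀ * CartanMatrix.E₈ * g = CartanMatrix.E₈)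
    (h12 : g ^ 12 = 1) {x y : Fin 8 → ℤ} (hx : x ⬝ᵥ CartanMatrix.E₈ *ᵥ x = 2)
    (hy : y ⬝ᵥ CartanMatrix.E₈ *ᵥ y = 2) (h : profile g x = (0, 0, 0, -1, 0, 0)) :
    correlation g y 4 = -1 := by
  simp only [profile, Prod.mk.injEq] at h
  obtain ⟨h₁, h₂, h₃, h₄, h₅, h₆⟩ := h
  have hG := inner_pow_eq_cyclicProfile hg h12 hx
  rw [h₁, h₂, h₃, h₄, h₅, h₆] at hG
  let U : Matrix (Fin 8) (Fin 8) ℤ := of fun i => g ^ (i : ℕ) *ᵥ x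
  -- The matrix is 3 times the inverse of the Gram matrix of A_2^4, whose blocks pair i with i + 4.
  have hU : (of ![![2, 0, 0, 0, 1, 0, 0, 0], ![0, 2, 0, 0, 0, 1, 0, 0],
      ![0, 0, 2, 0, 0, 0, 1, 0], ![0, 0, 0, 2, 0, 0, 0, 1], ![1, 0, 0, 0, 2, 0, 0, 0],
      ![0, 1, 0, 0, 0, 2, 0, 0], ![0, 0, 1, 0, 0, 0, 2, 0], ![0, 0, 0, 1, 0, 0, 0, 2]] * U) *
      (CartanMatrix.E₈ * Uᵀ) = (3 : ℤ) • (1 : Matrix (Fin 8) (Fin 8) ℤ) := by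
    have hUU : U * (CartanMatrix.E₈ * Uᵀ) = of fun i j : Fin 8 =>
        cyclicProfile 0 0 0 (-1) 0 0 (j.castLE (by decide) - i.castLE (by decide)) := by
      ext i j
      exact hG (i.castLE (by decide)) (j.castLE (by decide))
    rw [Matrix.mul_assoc, hUU]
    decide +kernel
  have hdet : U.det ≠ 0 := by
    intro h0
    have := congrArg det hU
    rw [det_mul, det_mul, h0, mul_zero, zero_mul, det_smul] at this
    simp at this
  have hPx : x + g ^ 4 *ᵥ x + g ^ 8 *ᵥ x = 0 := by
    apply eq_zero_of_e8_norm_eq_zero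
    have h04 := hG 0 4
    have h08 := hG 0 8
    have h44 := hG 4 4
    have h48 := hG 4 8
    have h88 := hG 8 8
    simp [cyclicProfile] at h04 h08 h44 h48 h88
    simp only [mulVec_add, add_dotProduct, dotProduct_add]
    rw [e8_inner_comm (g ^ 4 *ᵥ x) x, e8_inner_comm (g ^ 8 *ᵥ x) x,
      e8_inner_comm (g ^ 8 *ᵥ x) (g ^ 4 *ᵥ x), hx]
    simp only [mulVec_mulVec, h04, h08, h44, h48, h88]
    norm_num
  have hz : U *ᵥ (CartanMatrix.E₈ *ᵥ (y + g ^ 4 *ᵥ y + g ^ 8 *ᵥ y)) = 0 := by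
    funext i
    -- Since 8 + 4 = 12, the powers g^4 and g^8 move to the other argument as g^8 and g^4.
    have e4 := inner_pow_pow hg (g ^ (i : ℕ) *ᵥ x) y 8 4
    have e8 := inner_pow_pow hg (g ^ (i : ℕ) *ᵥ x) y 4 8
    norm_num [h12] at e4 e8
    change (g ^ (i : ℕ) *ᵥ x) ⬝ᵥ (CartanMatrix.E₈ *ᵥ (y + g ^ 4 *ᵥ y + g ^ 8 *ᵥ y)) = 0
    simp only [mulVec_add, dotProduct_add, mulVec_mulVec]
    rw [← e4, ← e8, ← add_dotProduct, ← add_dotProduct, ← pow_add, ← pow_add, add_comm 8,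
      add_comm 4, pow_add, pow_add, ← mulVec_mulVec, ← mulVec_mulVec, ← mulVec_add, ← mulVec_add,
      add_right_comm, hPx, mulVec_zero, zero_dotProduct]
  have hCz := eq_zero_of_mulVec_eq_zero hdet hz
  have hyz : y ⬝ᵥ CartanMatrix.E₈ *ᵥ (y + g ^ 4 *ᵥ y + g ^ 8 *ᵥ y) = 0 := by
    rw [hCz, dotProduct_zero]
  have h48 := correlation_reflect hg h12 y (i := 8) (j := 4) rfl
  simp only [mulVec_add, dotProduct_add, mulVec_mulVec, hy] at hyz
  change 2 + correlation g y 4 + correlation g y 8 = 0 at hyz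
  omega

end Profile

/-! ### Trace identities from sums over the roots -/

section Sums

variable {g : Matrix (Fin 8) (Fin 8) ℤ}

theorem sum_const_e8Roots (c : ℤ) : ∑ _n ∈ e8RootCodes, c = 120 * c := by
  rw [Finset.sum_const, show e8RootCodes.card = 120 from rfl]
  simp

/-- Here g^k r - r has norm 4 - 2 · 2 = 0 for every listed root, and these include a basis. -/
theorem pow_eq_one_of_correlation_eq_two (hg : gᵀ * CartanMatrix.E₈ * g = CartanMatrix.E₈)
    {k : ℕ} (h : ∀ n ∈ e8RootCodes, correlation g (digitVector n) k = 2) : g ^ k = 1 := by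
  have hfix : ∀ n ∈ e8RootCodes, g ^ k *ᵥ digitVector n = digitVector n := by
    intro n hn
    rw [← sub_eq_zero]
    apply eq_zero_of_e8_norm_eq_zero
    have e1 := h n hn
    rw [correlation, ← mulVec_mulVec] at e1
    have hx : digitVector n ⬝ᵥ CartanMatrix.E₈ *ᵥ digitVector n = 2 := e8Root_norm n hn
    have e2 := inner_pow_pow hg (digitVector n) (digitVector n) k 0
    rw [add_zero, pow_zero, Matrix.mul_one, hx] at e2
    simp only [mulVec_sub, sub_dotProduct, dotProduct_sub, e1, e2, hx,
      e8_inner_comm (g ^ k *ᵥ digitVector n) (digitVector n)]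
    norm_num
  ext i j
  obtain ⟨n, hn, hj⟩ := single_mem_e8Roots j
  have := congr_fun (hfix n hn) i
  rw [hj] at this
  simpa [one_apply, Pi.single_apply] using this

/-- No root spans, with its orbit, a sublattice of type `A₂⁴`. -/
theorem profile_ne_four_triangles (hg : gᵀ * CartanMatrix.E₈ * g = CartanMatrix.E₈)
    (h12 : g ^ 12 = 1)
    (hP : ∀ n ∈ e8RootCodes, profile g (digitVector n) ∈ admissibleProfiles) :
    ∀ n ∈ e8RootCodes, profile g (digitVector n) ≠ (0, 0, 0, -1, 0, 0) := by
  intro m hm hE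
  -- Now (r, g^4 r) = -1 for every root, so three profiles remain, and the relations hold in each.
  have h : ∀ n ∈ e8RootCodes,
      correlation g (digitVector n) 1 * correlation g (digitVector n) (1 + 0) =
        -correlation g (digitVector n) 1 ∧
      correlation g (digitVector n) 1 * correlation g (digitVector n) (1 + 1) =
        -correlation g (digitVector n) 1 ∧
      correlation g (digitVector n) 3 = -2 * correlation g (digitVector n) 1 ∧
      0 ≤ correlation g (digitVector n) 2 + 1 := by
    intro n hn
    have h4 := correlation_four_eq_neg_one hg h12 (e8Root_norm m hm) (e8Root_norm n hn) hE
    have hp := hP n hn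
    simp only [profile, admissibleProfiles, List.mem_cons, List.not_mem_nil, or_false,
      Prod.mk.injEq] at hp
    rcases hp with hp | hp | hp | hp | hp | hp | hp | hp | hp | hp | hp | hp | hp | hp | hp |
        hp | hp <;>
      obtain ⟨h₁, h₂, h₃, h₄, h₅, h₆⟩ := hp <;> simp [h₁, h₂, h₃, h₄] at h4 ⊢
  have s1 := sum_correlation (g := g) 1
  have s2 := sum_correlation (g := g) 2
  have s3 := sum_correlation (g := g) 3
  have m11 := sum_correlation_mul hg 1 0
  have m12 := sum_correlation_mul hg 1 1
  rw [Finset.sum_congr rfl fun n hn => (h n hn).1, Finset.sum_neg_distrib, s1] at m11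
  rw [Finset.sum_congr rfl fun n hn => (h n hn).2.1, Finset.sum_neg_distrib, s1] at m12
  rw [Finset.sum_congr rfl fun n hn => (h n hn).2.2.1, ← Finset.mul_sum, s1] at s3
  have s2' : ∑ n ∈ e8RootCodes, (correlation g (digitVector n) 2 + 1) =
      30 * (g ^ 2).trace + 120 := by
    rw [Finset.sum_add_distrib, s2, sum_const_e8Roots, mul_one]
  have hnn : 0 ≤ ∑ n ∈ e8RootCodes, (correlation g (digitVector n) 2 + 1) :=
    Finset.sum_nonneg fun n hn => (h n hn).2.2.2
  simp only [pow_zero, trace_one, Fintype.card_fin, add_zero] at m11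
  norm_num only [] at m11 m12 s3 s2' hnn
  rw [s2'] at hnn
  have hprod : (g ^ 1).trace * ((g ^ 2).trace + 4) = 0 := by linarith
  -- If t_1 = 0, then t_2 = -8 and the nonnegative sum equals -120. If t_2 = -4, then (r, g^2 r) =
  -- -1 for all roots, but it is 0 for the root at hand.
  rcases mul_eq_zero.mp hprod with h0 | h0
  · rw [h0] at m11
    linarith
  · have : ∑ n ∈ e8RootCodes, (correlation g (digitVector n) 2 + 1) = 0 := by linarith
    rw [Finset.sum_eq_zero_iff_of_nonneg fun n hn => (h n hn).2.2.2] at this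
    have hm2 := this m hm
    simp only [profile, Prod.mk.injEq] at hE
    omega

theorem sum_linear_correlation (c₀ c₂ c₄ c₆ : ℤ) :
    ∑ n ∈ e8RootCodes, (c₀ + c₂ * correlation g (digitVector n) 2 +
      c₄ * correlation g (digitVector n) 4 + c₆ * correlation g (digitVector n) 6) =
    120 * c₀ + 30 * (c₂ * (g ^ 2).trace + c₄ * (g ^ 4).trace + c₆ * (g ^ 6).trace) := by
  simp only [Finset.sum_add_distrib, ← Finset.mul_sum, sum_correlation, sum_const_e8Roots]
  ring

theorem sum_quadratic_correlation (hg : gᵀ * CartanMatrix.E₈ * g = CartanMatrix.E₈) (h12 : g ^ 12 = 1)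
    (c₀ c₂ c₄ c₆ d₀ d₂ d₄ d₆ : ℤ) :
    ∑ n ∈ e8RootCodes, (c₀ + c₂ * correlation g (digitVector n) 2 +
        c₄ * correlation g (digitVector n) 4 + c₆ * correlation g (digitVector n) 6) *
      (d₀ + d₂ * correlation g (digitVector n) 2 +
        d₄ * correlation g (digitVector n) 4 + d₆ * correlation g (digitVector n) 6) =
    120 * c₀ * d₀ + 30 * ((c₀ * d₂ + c₂ * d₀) * (g ^ 2).trace +
      (c₀ * d₄ + c₄ * d₀) * (g ^ 4).trace + (c₀ * d₆ + c₆ * d₀) * (g ^ 6).trace) +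
    6 * (c₂ * d₂ * ((g ^ 2).trace ^ 2 + 8 + (g ^ 4).trace) +
      c₄ * d₄ * ((g ^ 4).trace ^ 2 + 8 + (g ^ 4).trace) +
      c₆ * d₆ * ((g ^ 6).trace ^ 2 + 16) +
      (c₂ * d₄ + c₄ * d₂) * ((g ^ 2).trace * (g ^ 4).trace + (g ^ 2).trace + (g ^ 6).trace) +
      (c₂ * d₆ + c₆ * d₂) * ((g ^ 2).trace * (g ^ 6).trace + 2 * (g ^ 4).trace) +
      (c₄ * d₆ + c₆ * d₄) * ((g ^ 4).trace * (g ^ 6).trace + 2 * (g ^ 2).trace)) := by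
  have t8 : (g ^ 8).trace = (g ^ 4).trace := trace_pow_reflect hg h12 rfl
  have t10 : (g ^ 10).trace = (g ^ 2).trace := trace_pow_reflect hg h12 rfl
  have m22 := sum_correlation_mul hg 2 0
  have m44 := sum_correlation_mul hg 4 0
  have m66 := sum_correlation_mul hg 6 0
  have m24 := sum_correlation_mul hg 2 2
  have m26 := sum_correlation_mul hg 2 4
  have m46 := sum_correlation_mul hg 4 2
  norm_num [t8, t10, h12] at m22 m44 m66 m24 m26 m46
  have e : ∀ n, (c₀ + c₂ * correlation g (digitVector n) 2 +
        c₄ * correlation g (digitVector n) 4 + c₆ * correlation g (digitVector n) 6) *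
      (d₀ + d₂ * correlation g (digitVector n) 2 +
        d₄ * correlation g (digitVector n) 4 + d₆ * correlation g (digitVector n) 6) =
      (c₀ * d₀ + (c₀ * d₂ + c₂ * d₀) * correlation g (digitVector n) 2 +
        (c₀ * d₄ + c₄ * d₀) * correlation g (digitVector n) 4 +
        (c₀ * d₆ + c₆ * d₀) * correlation g (digitVector n) 6) +
      c₂ * d₂ * (correlation g (digitVector n) 2 * correlation g (digitVector n) 2) +
      c₄ * d₄ * (correlation g (digitVector n) 4 * correlation g (digitVector n) 4) +
      c₆ * d₆ * (correlation g (digitVector n) 6 * correlation g (digitVector n) 6) +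
      (c₂ * d₄ + c₄ * d₂) *
        (correlation g (digitVector n) 2 * correlation g (digitVector n) 4) +
      (c₂ * d₆ + c₆ * d₂) *
        (correlation g (digitVector n) 2 * correlation g (digitVector n) 6) +
      (c₄ * d₆ + c₆ * d₄) *
        (correlation g (digitVector n) 4 * correlation g (digitVector n) 6) :=
    fun n => by ring
  rw [Finset.sum_congr rfl fun n _ => e n]
  simp only [Finset.sum_add_distrib,
    ← Finset.mul_sum, sum_correlation, sum_const_e8Roots, m22, m44, m66, m24, m26, m46]
  ring

end Sums

/-! ### Exclusion of primitive 12th roots of unity, and conclusion -/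

section Final

variable {g : Matrix (Fin 8) (Fin 8) ℤ}

/-- No root spans, with its orbit, a sublattice of type `A₁⁶`. -/
theorem profile_ne_six_orthogonal (hg : gᵀ * CartanMatrix.E₈ * g = CartanMatrix.E₈)
    (h12 : g ^ 12 = 1)
    (hP : ∀ n ∈ e8RootCodes, profile g (digitVector n) ∈ admissibleProfiles) :
    ∀ n ∈ e8RootCodes, profile g (digitVector n) ≠ (0, 0, 0, 0, 0, -2) := by
  intro m hm hC
  -- Let X and Y be the two linear forms multiplied here. X is 3 times the squared norm of the
  -- projection of r to the eigenspaces of primitive 12th roots of unity, and Y is 6 times that for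
  -- ±i. In the remaining profiles X is 4 for the excluded one and 0 otherwise, and Y = 4 where X =
  -- 4; so X² = XY = 4X.
  have h : ∀ n ∈ e8RootCodes,
      (2 + 1 * correlation g (digitVector n) 2 + (-1) * correlation g (digitVector n) 4 +
        (-1) * correlation g (digitVector n) 6) *
      (2 + 1 * correlation g (digitVector n) 2 + (-1) * correlation g (digitVector n) 4 +
        (-1) * correlation g (digitVector n) 6) =
      8 + 4 * correlation g (digitVector n) 2 + (-4) * correlation g (digitVector n) 4 +
        (-4) * correlation g (digitVector n) 6 ∧
      (2 + 1 * correlation g (digitVector n) 2 + (-1) * correlation g (digitVector n) 4 +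
        (-1) * correlation g (digitVector n) 6) *
      (2 + (-2) * correlation g (digitVector n) 2 + 2 * correlation g (digitVector n) 4 +
        (-1) * correlation g (digitVector n) 6) =
      8 + 4 * correlation g (digitVector n) 2 + (-4) * correlation g (digitVector n) 4 +
        (-4) * correlation g (digitVector n) 6 ∧
      0 ≤ 8 + 4 * correlation g (digitVector n) 2 + (-4) * correlation g (digitVector n) 4 +
        (-4) * correlation g (digitVector n) 6 ∧
      0 ≤ 2 + 0 * correlation g (digitVector n) 2 + 0 * correlation g (digitVector n) 4 +
        1 * correlation g (digitVector n) 6 ∧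
      0 ≤ 2 + 1 * correlation g (digitVector n) 2 + 0 * correlation g (digitVector n) 4 +
        0 * correlation g (digitVector n) 6 ∧
      (correlation g (digitVector n) 6 = -2 → correlation g (digitVector n) 1 = 0) := by
    intro n hn
    have hne := profile_ne_four_triangles hg h12 hP n hn
    have hp := hP n hn
    simp only [profile, admissibleProfiles, List.mem_cons, List.not_mem_nil, or_false,
      Prod.mk.injEq] at hp hne
    rcases hp with hp | hp | hp | hp | hp | hp | hp | hp | hp | hp | hp | hp | hp | hp | hp |
        hp | hp <;>
      obtain ⟨h₁, h₂, h₃, h₄, h₅, h₆⟩ := hp <;> simp [h₁, h₂, h₃, h₄, h₅, h₆] at hne ⊢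
  have hm' := h m hm
  simp only [profile, Prod.mk.injEq] at hC
  obtain ⟨h₁, h₂, h₃, h₄, h₅, h₆⟩ := hC
  have sX := sum_linear_correlation (g := g) 8 4 (-4) (-4)
  have s6 := sum_linear_correlation (g := g) 2 0 0 1
  have s2 := sum_linear_correlation (g := g) 2 1 0 0
  have mXX := sum_quadratic_correlation hg h12 2 1 (-1) (-1) 2 1 (-1) (-1)
  have mXY := sum_quadratic_correlation hg h12 2 1 (-1) (-1) 2 (-2) 2 (-1)
  rw [Finset.sum_congr rfl fun n hn => (h n hn).1, sX] at mXX
  rw [Finset.sum_congr rfl fun n hn => (h n hn).2.1, sX] at mXY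
  have hpos : 0 < ∑ n ∈ e8RootCodes, (8 + 4 * correlation g (digitVector n) 2 +
      (-4) * correlation g (digitVector n) 4 + (-4) * correlation g (digitVector n) 6) :=
    Finset.sum_pos' (fun n hn => (h n hn).2.2.1) ⟨m, hm, by rw [h₂, h₄, h₆]; norm_num⟩
  rw [sX] at hpos
  set c₂ := (g ^ 2).trace
  set c₄ := (g ^ 4).trace
  set c₆ := (g ^ 6).trace
  have hT : (8 + c₂ - c₄ - c₆) * ((8 + c₂ - c₄ - c₆) - 14) = 0 := by linarith
  have hT' : 8 + c₂ - c₄ - c₆ = 14 := by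
    rcases mul_eq_zero.mp hT with h0 | h0
    · linarith
    · linarith
  have hS : (8 + c₂ - c₄ - c₆) * (8 - 2 * c₂ + 2 * c₄ - c₆) = 280 := by linarith
  rw [hT'] at hS
  have hc₆ : c₆ = -8 := by linarith
  rw [hc₆] at s6
  -- As t_6 = -8, every (r, g^6 r) is -2. Both profiles with this value have (r, gr) = 0, which
  -- forces t_1 = 0, t_2 = -8 and (r, g^2 r) = -2 throughout.
  have h6 := (Finset.sum_eq_zero_iff_of_nonneg fun n hn => (h n hn).2.2.2.1).mp
    (s6.trans (by norm_num))
  have h1 : ∀ n ∈ e8RootCodes, correlation g (digitVector n) 1 = 0 := fun n hn =>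
    (h n hn).2.2.2.2.2 (by linarith [h6 n hn])
  have s1 := sum_correlation (g := g) 1
  have m11 := sum_correlation_mul hg 1 0
  rw [Finset.sum_congr rfl h1, Finset.sum_const_zero] at s1
  rw [Finset.sum_congr rfl fun n hn => by rw [h1 n hn, zero_mul], Finset.sum_const_zero] at m11
  have hc₁ : (g ^ 1).trace = 0 := by linarith
  rw [hc₁, pow_zero, trace_one] at m11
  have hc₂ : c₂ = -8 := by
    simp only [Fintype.card_fin] at m11
    change 0 = 6 * (_ + _ + c₂) at m11
    push_cast at m11
    linarith
  rw [hc₂] at s2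
  have h2 := (Finset.sum_eq_zero_iff_of_nonneg fun n hn => (h n hn).2.2.2.2.1).mp
    (s2.trans (by norm_num)) m hm
  rw [h₂] at h2
  norm_num at h2

theorem pow_four_eq_one_or_pow_six_eq_one
    (hg : gᵀ * CartanMatrix.E₈ * g = CartanMatrix.E₈) (h12 : g ^ 12 = 1)
    (hroot : ∀ x, (g *ᵥ x - x) ⬝ᵥ CartanMatrix.E₈ *ᵥ (g *ᵥ x - x) ≠ 2) :
    g ^ 4 = 1 ∨ g ^ 6 = 1 := by
  have hP : ∀ n ∈ e8RootCodes, profile g (digitVector n) ∈ admissibleProfiles := fun n hn =>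
    profile_mem_admissibleProfiles hg h12 hroot (e8Root_norm n hn)
  have h : ∀ n ∈ e8RootCodes,
      2 + 1 * correlation g (digitVector n) 2 + (-1) * correlation g (digitVector n) 4 +
        (-1) * correlation g (digitVector n) 6 = 0 ∧
      (2 + 0 * correlation g (digitVector n) 2 + (-1) * correlation g (digitVector n) 4 +
        0 * correlation g (digitVector n) 6) *
      (2 + 0 * correlation g (digitVector n) 2 + 0 * correlation g (digitVector n) 4 +
        (-1) * correlation g (digitVector n) 6) = 0 ∧
      0 ≤ 2 + 0 * correlation g (digitVector n) 2 + (-1) * correlation g (digitVector n) 4 +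
        0 * correlation g (digitVector n) 6 ∧
      0 ≤ 2 + 0 * correlation g (digitVector n) 2 + 0 * correlation g (digitVector n) 4 +
        (-1) * correlation g (digitVector n) 6 := by
    intro n hn
    have hne := profile_ne_four_triangles hg h12 hP n hn
    have hne' := profile_ne_six_orthogonal hg h12 hP n hn
    have hp := hP n hn
    simp only [profile, admissibleProfiles, List.mem_cons, List.not_mem_nil, or_false,
      Prod.mk.injEq] at hp hne hne'
    rcases hp with hp | hp | hp | hp | hp | hp | hp | hp | hp | hp | hp | hp | hp | hp | hp |
        hp | hp <;>
      obtain ⟨h₁, h₂, h₃, h₄, h₅, h₆⟩ := hp <;> simp [h₁, h₂, h₃, h₄, h₅, h₆] at hne hne' ⊢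
  have sX := sum_linear_correlation (g := g) 2 1 (-1) (-1)
  have s4 := sum_linear_correlation (g := g) 2 0 (-1) 0
  have s6 := sum_linear_correlation (g := g) 2 0 0 (-1)
  have m46 := sum_quadratic_correlation hg h12 2 0 (-1) 0 2 0 0 (-1)
  rw [Finset.sum_congr rfl fun n hn => (h n hn).1, Finset.sum_const_zero] at sX
  rw [Finset.sum_congr rfl fun n hn => (h n hn).2.1, Finset.sum_const_zero] at m46
  -- `sX` gives t_2 = t_4 + t_6 - 8; with this, `m46` factors.
  have hprod : (8 - (g ^ 4).trace) * (8 - (g ^ 6).trace) = 0 := by linarith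
  refine (mul_eq_zero.mp hprod).imp (fun h0 => ?_) (fun h0 => ?_)
  · refine pow_eq_one_of_correlation_eq_two hg fun n hn => ?_
    have := (Finset.sum_eq_zero_iff_of_nonneg fun n hn => (h n hn).2.2.1).mp
      (s4.trans (by linarith)) n hn
    linarith
  · refine pow_eq_one_of_correlation_eq_two hg fun n hn => ?_
    have := (Finset.sum_eq_zero_iff_of_nonneg fun n hn => (h n hn).2.2.2).mp
      (s6.trans (by linarith)) n hn
    linarith

end Final

theorem theorem4p24 :
    ¬ ∃ h : latticeIsometryGroup e8Form, orderOf h = 12 ∧ IsRootless e8Form h := by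
  rintro ⟨h, hord, hroot⟩
  let L : (Fin 8 → ℤ) →ₗ[ℤ] (Fin 8 → ℤ) := (h : (Fin 8 → ℤ) ≃ₗ[ℤ] (Fin 8 → ℤ)).toLinearMap
  let g := LinearMap.toMatrix' L
  have hgx : ∀ x, g *ᵥ x = (h : (Fin 8 → ℤ) ≃ₗ[ℤ] (Fin 8 → ℤ)) x := fun x =>
    LinearMap.toMatrix'_mulVec L x
  have hpow : ∀ k x, g ^ k *ᵥ x = ((h ^ k : latticeIsometryGroup e8Form) :
      (Fin 8 → ℤ) ≃ₗ[ℤ] (Fin 8 → ℤ)) x := by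
    intro k
    induction k with
    | zero => intro x; simp
    | succ k ih =>
      intro x
      rw [pow_succ, pow_succ, ← mulVec_mulVec, ih, hgx]
      rfl
  have hpow_one : ∀ k, g ^ k = 1 ↔ h ^ k = 1 := by
    intro k
    constructor
    · intro hk
      ext1
      ext1 x
      rw [← hpow, hk, one_mulVec]
      rfl
    · intro hk
      refine ext_of_mulVec_single fun i => ?_
      rw [hpow, hk, one_mulVec]
      rfl
  have hg : gᵀ * CartanMatrix.E₈ * g = CartanMatrix.E₈ := by
    have hB : ∀ x y, (g *ᵥ x) ⬝ᵥ CartanMatrix.E₈ *ᵥ (g *ᵥ y) = x ⬝ᵥ CartanMatrix.E₈ *ᵥ y := by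
      intro x y
      rw [hgx, hgx, ← toBilin'_apply', ← toBilin'_apply']
      exact h.2 x y
    ext i j
    have hij := hB (Pi.single i 1) (Pi.single j 1)
    rw [← vecMul_transpose, ← dotProduct_mulVec, mulVec_mulVec, mulVec_mulVec] at hij
    simpa using hij
  have h12 : g ^ 12 = 1 := (hpow_one 12).2 (hord ▸ pow_orderOf_eq_one h)
  have hroot' : ∀ x, (g *ᵥ x - x) ⬝ᵥ CartanMatrix.E₈ *ᵥ (g *ᵥ x - x) ≠ 2 := by
    intro x hx
    refine hroot (g *ᵥ x - x) ⟨x, ?_⟩ ?_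
    · rw [hgx]
      rfl
    · rw [IsLatticeRoot, e8Form, toBilin'_apply']
      exact hx
  rcases pow_four_eq_one_or_pow_six_eq_one hg h12 hroot' with hk | hk
  · have := orderOf_dvd_of_pow_eq_one ((hpow_one 4).1 hk)
    rw [hord] at this
    norm_num at this
  · have := orderOf_dvd_of_pow_eq_one ((hpow_one 6).1 hk)
    rw [hord] at this
    norm_num at this
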